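/- Let $P$ be the set of all integer partitions (including the empty partition $\emptyset$), ordered by containment of Young diagrams: if $\sigma=(s_1\ge\dots\ge s_r)$ and $\pi=(n_1\ge\dots\ge n_t)$, then $\sigma\le\pi$ if and only if $r\le t$ and $s_i\le n_i$ for all $i\le r$. Let $Y^*=\langle P,\le,[1]+[1]\rangle$ be this ordered set with a constant for the partition $[1]+[1]=(1,1)$. For a structure $\langle A,\tau\rangle$, let $\mathrm{Def}(A,\tau)$ be the set of all relations $R\subseteq A^k$, $k\in\mathbb N$, that are first-order definable in it without parameters. For a bijection $c:A\to\mathbb N=\{0,1,2,\dots\}$, let $+_c$ and $\times_c$ be the ternary relations on $A$ given by $$(x,y,z)\in{+_c}\iff c(x)+c(y)=c(z),\qquad (x,y,z)\in{\times_c}\iff c(x)\cdot c(y)=c(z).$$ The structure $\langle A,\tau\rangle$ is arithmetic if $\mathrm{Def}(A,\tau)\subseteq\mathrm{Def}(A,+_c,\times_c)$ for some bijection $c:A\to\mathbb N$; it has the maximal definability property if, for some such $c$, $\mathrm{Def}(A,\tau)=\mathrm{Def}(A,+_c,\times_c)$. Let $p_1=2,p_2=3,p_3=5,\dots$ be the primes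 in increasing order, and define $\#:P\to\mathbb N$ as follows: $\#\emptyset=0$; if $\pi$ consists of $m\ge1$ parts, all equal to $1$, then $\#\pi=p_1^{m-1}$; for every other $\pi$, with distinct part sizes $n_1,\dots,n_k$ occurring exactly $m_1,\dots,m_k$ times respectively, $\#\pi=\prod_{i=1}^k p_{n_i}^{m_i}$. **Theorem 4.4.** The map $\#:P\to\mathbb N$ is a bijection, and $$\mathrm{Def}(P,\le,[1]+[1])=\mathrm{Def}(P,+_\#,\times_\#).$$ In particular, $Y^*$ has the maximal definability property. -/

import Mathlib

open scoped FirstOrder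

/-- The set of all relations, of any finite arity, on `A` that are first-order definable
(without parameters) in the `L`-structure `S` on `A`. -/
def definableRelations (L : FirstOrder.Language.{0, 0}) (A : Type) (S : L.Structure A) :
    Set (Σ k : ℕ, Set (Fin k → A)) :=
  {R | ∃ φ : L.Formula (Fin R.1), ∀ v : Fin R.1 → A, v ∈ R.2 ↔ φ.Realize v}

/-- Two ternary relation symbols, for the graphs of addition and multiplication. -/
inductive ArithmeticRel : ℕ → Type
  | add : ArithmeticRel 3
  | mul : ArithmeticRel 3

/-- The relational first-order language with the two ternary symbols of `ArithmeticRel`. -/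
def arithmeticLanguage : FirstOrder.Language.{0, 0} := ⟨fun _ => Empty, ArithmeticRel⟩

/-- The structure on `A` obtained by pulling back the graphs of addition and multiplication on `ℕ`
along a map `c : A → ℕ`. -/
abbrev pullbackArithmetic {A : Type} (c : A → ℕ) : arithmeticLanguage.Structure A where
  funMap := fun f _ => nomatch f
  RelMap := fun {_} R =>
    match R with
    | ArithmeticRel.add => fun v => c (v 0) + c (v 1) = c (v 2)
    | ArithmeticRel.mul => fun v => c (v 0) * c (v 1) = c (v 2)

/-- The structure `S` on `A` is arithmetic via the bijection `c`. -/
def IsArithmeticVia (L : FirstOrder.Language.{0, 0}) (A : Type) (S : L.Structure A) (c : A → ℕ) : Prop :=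
  Function.Bijective c ∧
    definableRelations L A S ⊆ definableRelations arithmeticLanguage A (pullbackArithmetic c)

/-- The maximal definability property: for some bijection with `ℕ` witnessing that the structure
is arithmetic, its definable relations are all of those definable from the pulled-back
arithmetic. -/
def HasMaximalDefinabilityProperty (L : FirstOrder.Language.{0, 0}) (A : Type) (S : L.Structure A) : Prop :=
  ∃ c : A → ℕ, IsArithmeticVia L A S c ∧
    definableRelations L A S = definableRelations arithmeticLanguage A (pullbackArithmetic c)

namespace YoungDiagram

/-- The partition `[1] + [1]` of `2`: two parts (rows) of size `1`. The parts of the partition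
with Young diagram `μ` are the row lengths `μ.rowLens`. -/
def oneAddOne : YoungDiagram := YoungDiagram.ofRowLens [1, 1] (by decide)

/-- The language with one binary relation symbol `≤` and one constant symbol. -/
abbrev starLanguage : FirstOrder.Language.{0, 0} := FirstOrder.Language.order[[Unit]]

/-- Young's lattice (partitions, i.e. Young diagrams, ordered by containment) with the partition
`[1] + [1]` as the interpretation of the constant symbol. -/
abbrev starStructure : starLanguage.Structure YoungDiagram :=
  letI : FirstOrder.Language.order.Structure YoungDiagram := FirstOrder.Language.orderStructure YoungDiagram
  letI : (FirstOrder.Language.constantsOn Unit).Structure YoungDiagram :=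
    FirstOrder.Language.constantsOn.structure fun _ => oneAddOne
  inferInstanceAs (FirstOrder.Language.order[[Unit]].Structure YoungDiagram)

/-- The `i`-th prime for `i ≥ 1`, so that the first one is `2`. -/
noncomputable def primeNumber (i : ℕ) : ℕ := Nat.nth Nat.Prime (i - 1)

/-- The prime-power code of a partition. The empty partition has code `0`; a partition into
`m ≥ 1` parts all equal to `1` has code `p₁ ^ (m - 1)`; any other partition, with distinct part
sizes `n` occurring `m_n` times, has code `∏ p_n ^ m_n`. -/
noncomputable def primeCode (μ : YoungDiagram) : ℕ :=
  if μ.rowLens = [] then 0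
  else if ∀ n ∈ μ.rowLens, n = 1 then primeNumber 1 ^ (μ.rowLens.length - 1)
  else ∏ n ∈ μ.rowLens.toFinset, primeNumber n ^ μ.rowLens.count n

end YoungDiagram

/-! ### Interpretations and the closure properties of definability -/

namespace FirstOrder.Language

/-! Each structure defines the primitives of the other, so by induction on formulas
(`definableRelations_subset`) they define the same relations. The hub is `codeColLen n j`, an
arithmetical function giving the `j`-th column length of the diagram with code `n`.

From arithmetic to the lattice: containment is columnwise comparison of `codeColLen`
(`le_iff_forall_codeColLen`), and the extra constant is a fixed element.

From the lattice to arithmetic: the constant breaks the transpose symmetry, so one-row and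
one-column diagrams are definable, giving two copies of the naturals. Bounding a diagram by its
first row and column defines membership of a cell (`mem_iff_forall_le`); staircases identify the two
copies (`eq_iff_exists_staircase`). Diagrams then serve as decreasing sequences witnessing sums and
products (`add_eq_iff_exists`, `mul_eq_iff_exists`). With Gödel's beta function every recursive
definition needed becomes available, in particular `codeColLen`, and comparing it with actual cells
defines the graph of `primeCode` (`primeCode_eq_iff`).

Bijectivity of the code is unique factorization, corrected at the powers of 2 by `codeMult`. -/

/-- An interpretation of the type `X` in the `L`-structure `M`: elements of `X` are coded
injectively by finite tuples from `M`, and the set of codes is definable. -/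
class Coded (L : Language.{0, 0}) (M : Type) [L.Structure M] (X : Type) where
  Idx : Type
  [finite_idx : Finite Idx]
  code : X → Idx → M
  code_injective : Function.Injective code
  definable_range : ∃ φ : L.Formula Idx, ∀ v, φ.Realize v ↔ v ∈ Set.range code

attribute [instance] Coded.finite_idx

open Coded

section Coded

variable (L : Language.{0, 0}) (M : Type) [L.Structure M]

/-- Every structure is interpreted in itself. -/
instance Coded.self : Coded L M M where
  Idx := Unit
  code x _ := x
  code_injective _ _ h := congrFun h ()
  definable_range := ⟨⊤, fun v => by
    simp only [Formula.realize_top, true_iff]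
    exact ⟨v (), rfl⟩⟩

instance Coded.prod (X Y : Type) [Coded L M X] [Coded L M Y] : Coded L M (X × Y) where
  Idx := Idx L M X ⊕ Idx L M Y
  code x := Sum.elim (code x.1) (code x.2)
  code_injective := fun ⟨a, b⟩ ⟨c, d⟩ h => by
    exact Prod.ext (code_injective (L := L) (M := M) (funext fun i => congrFun h (Sum.inl i)))
      (code_injective (L := L) (M := M) (funext fun i => congrFun h (Sum.inr i)))
  definable_range := by
    obtain ⟨φ, hφ⟩ := definable_range (L := L) (M := M) (X := X)
    obtain ⟨ψ, hψ⟩ := definable_range (L := L) (M := M) (X := Y)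
    refine ⟨φ.relabel Sum.inl ⊓ ψ.relabel Sum.inr, fun v => ?_⟩
    rw [Formula.realize_inf, Formula.realize_relabel, Formula.realize_relabel, hφ, hψ]
    constructor
    · rintro ⟨⟨x, hx⟩, ⟨y, hy⟩⟩
      refine ⟨(x, y), ?_⟩
      ext (i | i)
      · exact congrFun hx i
      · exact congrFun hy i
    · rintro ⟨⟨x, y⟩, rfl⟩
      exact ⟨⟨x, rfl⟩, ⟨y, rfl⟩⟩

variable {X Y Z : Type} [Coded L M X] [Coded L M Y] [Coded L M Z]

/-- A predicate on an interpreted type is definable in the ambient structure. -/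
@[fun_prop]
def DRel (p : X → Prop) : Prop :=
  ∃ φ : L.Formula (Idx L M X), ∀ x, φ.Realize (code x) ↔ p x

/-- A function between interpreted types has a graph definable in the ambient structure. -/
@[fun_prop]
def DFun (f : X → Y) : Prop :=
  DRel L M fun q : X × Y => f q.1 = q.2

/-- A function between interpreted types that selects coordinates of codes. -/
def Reindexing (f : X → Y) : Prop :=
  ∃ σ : Idx L M Y → Idx L M X, ∀ x, code x ∘ σ = code (f x)

variable {L M}

theorem Reindexing.id : Reindexing L M fun x : X => x := ⟨_root_.id, fun _ => rfl⟩

theorem Reindexing.fst {f : X → Y × Z} : Reindexing L M f → Reindexing L M fun x => (f x).1 :=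
  fun ⟨σ, hσ⟩ => ⟨σ ∘ Sum.inl, fun x => by rw [← Function.comp_assoc, hσ]; rfl⟩

theorem Reindexing.snd {f : X → Y × Z} : Reindexing L M f → Reindexing L M fun x => (f x).2 :=
  fun ⟨σ, hσ⟩ => ⟨σ ∘ Sum.inr, fun x => by rw [← Function.comp_assoc, hσ]; rfl⟩

theorem Reindexing.pair {f : X → Y} {g : X → Z} :
    Reindexing L M f → Reindexing L M g → Reindexing L M fun x => (f x, g x) :=
  fun ⟨σ, hσ⟩ ⟨τ, hτ⟩ => ⟨Sum.elim σ τ, fun x => by rw [Sum.comp_elim, hσ, hτ]; rfl⟩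

/-- Only variables are renamed, so no definable function has to be eliminated. This bootstraps
`DFun.comp` and `DFun.pair`, from which substitution of arbitrary definable functions follows in
`DRel.comp`. -/
theorem DRel.reindex {p : Y → Prop} (hp : DRel L M p) {f : X → Y} (hf : Reindexing L M f) :
    DRel L M fun x => p (f x) := by
  obtain ⟨φ, hφ⟩ := hp
  obtain ⟨σ, hσ⟩ := hf
  exact ⟨φ.relabel σ, fun x => by rw [Formula.realize_relabel, hσ, hφ]⟩

@[fun_prop]
theorem DRel.not {p : X → Prop} : DRel L M p → DRel L M fun x => ¬ p x :=
  fun ⟨φ, hφ⟩ => ⟨φ.not, fun x => by rw [Formula.realize_not, hφ]⟩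

@[fun_prop]
theorem DRel.and {p q : X → Prop} :
    DRel L M p → DRel L M q → DRel L M fun x => p x ∧ q x :=
  fun ⟨φ, hφ⟩ ⟨ψ, hψ⟩ => ⟨φ ⊓ ψ, fun x => by rw [Formula.realize_inf, hφ, hψ]⟩

@[fun_prop]
theorem DRel.or {p q : X → Prop} :
    DRel L M p → DRel L M q → DRel L M fun x => p x ∨ q x :=
  fun ⟨φ, hφ⟩ ⟨ψ, hψ⟩ => ⟨φ ⊔ ψ, fun x => by rw [Formula.realize_sup, hφ, hψ]⟩

@[fun_prop]
theorem DRel.imp {p q : X → Prop} :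
    DRel L M p → DRel L M q → DRel L M fun x => p x → q x :=
  fun ⟨φ, hφ⟩ ⟨ψ, hψ⟩ => ⟨φ.imp ψ, fun x => by rw [Formula.realize_imp, hφ, hψ]⟩

@[fun_prop]
theorem DRel.iff {p q : X → Prop} :
    DRel L M p → DRel L M q → DRel L M fun x => p x ↔ q x :=
  fun ⟨φ, hφ⟩ ⟨ψ, hψ⟩ => ⟨φ.iff ψ, fun x => by rw [Formula.realize_iff, hφ, hψ]⟩

/-- A quantifier over `Y` becomes a block of quantifiers over the coordinates, relativized to the
definable set of codes. -/
theorem DRel.proj {p : X × Y → Prop} (h : DRel L M p) :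
    DRel L M fun x => ∃ y, p (x, y) := by
  obtain ⟨φ, hφ⟩ := h
  obtain ⟨ψ, hψ⟩ := definable_range (L := L) (M := M) (X := Y)
  refine ⟨(φ ⊓ ψ.relabel Sum.inr).iExs (Idx L M Y), fun x => ?_⟩
  simp only [Formula.realize_iExs, Formula.realize_inf, Formula.realize_relabel,
    Sum.elim_comp_inr, hψ]
  constructor
  · rintro ⟨_, h, y, rfl⟩
    exact ⟨y, (hφ (x, y)).1 h⟩
  · rintro ⟨y, h⟩
    exact ⟨code y, (hφ (x, y)).2 h, y, rfl⟩

@[fun_prop]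
theorem DRel.exists {p : X → Y → Prop} (h : DRel L M fun q : X × Y => p q.1 q.2) :
    DRel L M fun x => ∃ y, p x y :=
  h.proj

@[fun_prop]
theorem DRel.forall {p : X → Y → Prop} (h : DRel L M fun q : X × Y => p q.1 q.2) :
    DRel L M fun x => ∀ y, p x y := by
  simpa using h.not.proj.not

theorem DRel.congr {p q : X → Prop} (hp : DRel L M p) (h : ∀ x, q x ↔ p x) : DRel L M q :=
  (funext fun x => propext (h x)) ▸ hp

theorem DRel.const (p : Prop) : DRel L M fun _ : X => p := by
  by_cases hp : p
  · exact ⟨⊤, fun x => by simp [hp]⟩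
  · exact ⟨⊥, fun x => by simp [hp]⟩

/-- Codes are injective, so equality is coordinatewise; finitely many coordinates make this a
formula. -/
theorem DRel.diagonal : DRel L M fun q : X × X => q.1 = q.2 := by
  refine ⟨BoundedFormula.iInf fun i : Idx L M X =>
    (Term.equal (Term.var (Sum.inl i)) (Term.var (Sum.inr i)) :
      L.Formula (Idx L M X ⊕ Idx L M X)), fun q => ?_⟩
  rw [Formula.Realize, BoundedFormula.realize_iInf]
  constructor
  · intro h
    refine code_injective (L := L) (M := M) (funext fun i => ?_)
    have := h i
    rwa [← Formula.Realize, Formula.realize_equal] at this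
  · intro h i
    rw [← Formula.Realize, Formula.realize_equal]
    simp [code, h]

theorem Reindexing.dfun {f : X → Y} (hf : Reindexing L M f) : DFun L M f := by
  obtain ⟨σ, hσ⟩ := hf
  exact DRel.diagonal.reindex (f := fun q : X × Y => (f q.1, q.2))
    (Reindexing.pair ⟨Sum.inl ∘ σ, fun x => by rw [← hσ]; rfl⟩ Reindexing.id.snd)

@[fun_prop]
theorem DFun.id : DFun L M fun x : X => x := Reindexing.id.dfun

@[fun_prop]
theorem DFun.comp {g : Y → Z} {f : X → Y} (hg : DFun L M g) (hf : DFun L M f) :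
    DFun L M fun x => g (f x) := by
  have h₁ : DRel L M fun q : (X × Z) × Y => f q.1.1 = q.2 :=
    hf.reindex (f := fun q : (X × Z) × Y => (q.1.1, q.2))
      (Reindexing.pair Reindexing.id.fst.fst Reindexing.id.snd)
  have h₂ : DRel L M fun q : (X × Z) × Y => g q.2 = q.1.2 :=
    hg.reindex (f := fun q : (X × Z) × Y => (q.2, q.1.2))
      (Reindexing.pair Reindexing.id.snd Reindexing.id.fst.snd)
  exact (h₁.and h₂).proj.congr fun q => by simp

@[fun_prop]
theorem DFun.fst {f : X → Y × Z} (hf : DFun L M f) : DFun L M fun x => (f x).1 :=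
  DFun.comp (g := fun q : Y × Z => q.1) Reindexing.id.fst.dfun hf

@[fun_prop]
theorem DFun.snd {f : X → Y × Z} (hf : DFun L M f) : DFun L M fun x => (f x).2 :=
  DFun.comp (g := fun q : Y × Z => q.2) Reindexing.id.snd.dfun hf

@[fun_prop]
theorem DFun.pair {f : X → Y} {g : X → Z} (hf : DFun L M f) (hg : DFun L M g) :
    DFun L M fun x => (f x, g x) := by
  have h₁ := hf.reindex (f := fun q : X × Y × Z => (q.1, q.2.1))
    (Reindexing.pair Reindexing.id.fst Reindexing.id.snd.fst)
  have h₂ := hg.reindex (f := fun q : X × Y × Z => (q.1, q.2.2))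
    (Reindexing.pair Reindexing.id.fst Reindexing.id.snd.snd)
  exact (h₁.and h₂).congr fun q => by simp [Prod.ext_iff]

theorem DRel.comp {p : Y → Prop} (hp : DRel L M p) {f : X → Y} (hf : DFun L M f) :
    DRel L M fun x => p (f x) :=
  (DRel.and hf (hp.reindex (f := fun q : X × Y => q.2) Reindexing.id.snd)).proj.congr
    fun x => by simp

@[fun_prop]
theorem DRel.eq {f g : X → Y} (hf : DFun L M f) (hg : DFun L M g) :
    DRel L M fun x => f x = g x :=
  DRel.diagonal.comp (hf.pair hg)

theorem DFun.comp₂ {W : Type} [Coded L M W] {F : Y → Z → W}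
    (hF : DFun L M fun q : Y × Z => F q.1 q.2) {f : X → Y} {g : X → Z} (hf : DFun L M f)
    (hg : DFun L M g) : DFun L M fun x => F (f x) (g x) :=
  DFun.comp hF (hf.pair hg)

theorem DFun.of_graph {f : X → Y} {p : X → Y → Prop} (hp : DRel L M fun q : X × Y => p q.1 q.2)
    (h : ∀ x y, f x = y ↔ p x y) : DFun L M f :=
  hp.congr fun q => h q.1 q.2

end Coded

end FirstOrder.Language

/-! ### Recursive functions definable from addition and multiplication -/

namespace FirstOrder.Language

/-- An interpretation of the natural numbers for which addition and multiplication are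
definable. -/
class Arithmetical (L : Language.{0, 0}) (M : Type) [L.Structure M] extends Coded L M ℕ where
  add : DRel L M fun q : ℕ × ℕ × ℕ => q.1 + q.2.1 = q.2.2
  mul : DRel L M fun q : ℕ × ℕ × ℕ => q.1 * q.2.1 = q.2.2

section Arithmetical

variable {L : Language.{0, 0}} {M : Type} [L.Structure M] [Arithmetical L M]
  {X : Type} [Coded L M X]

@[fun_prop]
theorem DFun.add {f g : X → ℕ} (hf : DFun L M f) (hg : DFun L M g) :
    DFun L M fun x => f x + g x :=
  Arithmetical.add.comp (f := fun q : X × ℕ => (f q.1, g q.1, q.2)) (by fun_prop)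

@[fun_prop]
theorem DFun.mul {f g : X → ℕ} (hf : DFun L M f) (hg : DFun L M g) :
    DFun L M fun x => f x * g x :=
  Arithmetical.mul.comp (f := fun q : X × ℕ => (f q.1, g q.1, q.2)) (by fun_prop)

@[fun_prop]
theorem DFun.nat_const (n : ℕ) : DFun L M fun _ : X => n := by
  -- Zero is the only additive idempotent, and one the only other multiplicative idempotent.
  have h₀ : DFun L M fun _ : X => 0 :=
    .of_graph (p := fun _ y => y + y = y) (by fun_prop) (by simp [eq_comm])
  have h₁ : DFun L M fun _ : X => 1 :=
    .of_graph (p := fun _ y => y * y = y ∧ ¬ y + y = y) (by fun_prop) fun x y => by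
      constructor
      · rintro rfl; simp
      · rintro ⟨h, h'⟩
        exact (mul_right_cancel₀ (by simpa using h') (h.trans (one_mul y).symm)).symm
  induction n with
  | zero => exact h₀
  | succ n ih => exact ih.add h₁

@[fun_prop]
theorem DRel.le {f g : X → ℕ} (hf : DFun L M f) (hg : DFun L M g) :
    DRel L M fun x => f x ≤ g x :=
  DRel.congr (p := fun x => ∃ k, f x + k = g x) (by fun_prop) fun x => by
    simp [le_iff_exists_add, eq_comm]

@[fun_prop]
theorem DRel.lt {f g : X → ℕ} (hf : DFun L M f) (hg : DFun L M g) :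
    DRel L M fun x => f x < g x :=
  DRel.le (hf.add (.nat_const 1)) hg

@[fun_prop]
theorem DRel.dvd {f g : X → ℕ} (hf : DFun L M f) (hg : DFun L M g) :
    DRel L M fun x => f x ∣ g x :=
  DRel.congr (p := fun x => ∃ k, g x = f x * k) (by fun_prop) fun _ => Iff.rfl

@[fun_prop]
theorem DRel.prime {f : X → ℕ} (hf : DFun L M f) : DRel L M fun x => (f x).Prime :=
  DRel.congr (p := fun x => 2 ≤ f x ∧ ∀ m, m ∣ f x → m = 1 ∨ m = f x) (by fun_prop)
    fun _ => Nat.prime_def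

@[fun_prop]
theorem DFun.mod {f g : X → ℕ} (hf : DFun L M f) (hg : DFun L M g) :
    DFun L M fun x => f x % g x :=
  -- The first disjunct is the convention `n % 0 = n`.
  .of_graph (p := fun x y => (g x = 0 ∧ f x = y) ∨ (y < g x ∧ ∃ k, y + g x * k = f x))
    (by fun_prop) fun x y => by
      rcases Nat.eq_zero_or_pos (g x) with h | h
      · simp [h]
      · simp only [h.ne', false_and, false_or]
        constructor
        · rintro rfl
          exact ⟨Nat.mod_lt _ h, _, Nat.mod_add_div _ _⟩
        · rintro ⟨hy, k, hk⟩
          rw [← hk, Nat.add_mul_mod_self_left, Nat.mod_eq_of_lt hy]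

@[fun_prop]
theorem DFun.ite {c : X → Prop} [DecidablePred c] {f g : X → ℕ} (hc : DRel L M c)
    (hf : DFun L M f) (hg : DFun L M g) : DFun L M fun x => if c x then f x else g x := by
  have hc' : DRel L M fun q : X × ℕ => c q.1 := hc.comp (by fun_prop)
  exact .of_graph (p := fun x y => (c x ∧ f x = y) ∨ (¬ c x ∧ g x = y))
    ((hc'.and (by fun_prop)).or (hc'.not.and (by fun_prop)))
    fun x y => by by_cases h : c x <;> simp [h]

/-- Every finite sequence of natural numbers is an initial segment of a sequence
`i ↦ a % ((i + 1) * b + 1)`. -/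
theorem exists_mod_eq (s : ℕ → ℕ) (n : ℕ) :
    ∃ a b, ∀ i ≤ n, a % ((i + 1) * b + 1) = s i := by
  -- Gödel's beta function, with its single argument unpaired into `a` and `b`.
  refine ⟨(Nat.unbeta ((List.range (n + 1)).map s)).unpair.1,
    (Nat.unbeta ((List.range (n + 1)).map s)).unpair.2, fun i hi => ?_⟩
  simpa [Nat.beta] using Nat.beta_unbeta_coe ((List.range (n + 1)).map s) ⟨i, by simp; lia⟩

/-- A function defined by primitive recursion from a definable step is definable. -/
theorem DFun.of_rec {F : X → ℕ → ℕ} {g : X → ℕ} {H : X → ℕ → ℕ → ℕ → Prop} (hg : DFun L M g)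
    (hH : DRel L M fun q : X × ℕ × ℕ × ℕ => H q.1 q.2.1 q.2.2.1 q.2.2.2)
    (zero : ∀ x, F x 0 = g x) (succ : ∀ x i y, F x (i + 1) = y ↔ H x i (F x i) y) :
    DFun L M fun q : X × ℕ => F q.1 q.2 := by
  have hH' : DRel L M fun q : (((((X × ℕ) × ℕ) × ℕ) × ℕ) × ℕ) => H q.1.1.1.1.1 q.2
      (q.1.1.2 % ((q.2 + 1) * q.1.2 + 1)) (q.1.1.2 % ((q.2 + 1 + 1) * q.1.2 + 1)) :=
    hH.comp (f := fun q : (((((X × ℕ) × ℕ) × ℕ) × ℕ) × ℕ) => (q.1.1.1.1.1, q.2,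
      (q.1.1.2 % ((q.2 + 1) * q.1.2 + 1)), (q.1.1.2 % ((q.2 + 1 + 1) * q.1.2 + 1))))
      (by fun_prop)
  -- The pair `(a, b)` codes the whole computation up to stage `q.2`.
  refine .of_graph (p := fun q y => ∃ a b, a % ((0 + 1) * b + 1) = g q.1 ∧
    (∀ i, i < q.2 → H q.1 i (a % ((i + 1) * b + 1)) (a % ((i + 1 + 1) * b + 1))) ∧
    a % ((q.2 + 1) * b + 1) = y)
    (DRel.and (by fun_prop) ((DRel.imp (by fun_prop) hH').forall.and
      (by fun_prop))).exists.exists fun ⟨x, n⟩ y => ?_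
  constructor
  · rintro rfl
    obtain ⟨a, b, h⟩ := exists_mod_eq (F x) n
    refine ⟨a, b, (h 0 n.zero_le).trans (zero x), fun i hi => ?_, h n le_rfl⟩
    rw [h i hi.le, h (i + 1) hi, ← succ]
  · rintro ⟨a, b, h₀, h, rfl⟩
    -- `H` determines the next value, so every coded computation agrees with `F`.
    have key : ∀ i ≤ n, F x i = a % ((i + 1) * b + 1) := by
      intro i
      induction i with
      | zero => exact fun _ => (zero x).trans h₀.symm
      | succ i ih =>
        intro hi
        rw [succ, ih (by lia)]
        exact h i hi
    exact key n le_rfl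

@[fun_prop]
theorem DFun.pow {f g : X → ℕ} (hf : DFun L M f) (hg : DFun L M g) :
    DFun L M fun x => f x ^ g x :=
  DFun.comp₂ (.of_rec (g := fun _ => 1) (H := fun m _ z y => z * m = y) (by fun_prop)
    (by fun_prop) (by simp) (by simp [pow_succ])) hf hg

theorem DFun.sum_range {t : X → ℕ → ℕ} (ht : DFun L M fun q : X × ℕ => t q.1 q.2)
    {n : X → ℕ} (hn : DFun L M n) : DFun L M fun x => ∑ k ∈ Finset.range (n x), t x k := by
  have ht' : DFun L M fun q : X × ℕ × ℕ × ℕ => t q.1 q.2.1 :=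
    DFun.comp₂ ht (by fun_prop) (by fun_prop)
  exact DFun.comp₂ (F := fun x n => ∑ k ∈ Finset.range n, t x k)
    (.of_rec (F := fun x n => ∑ k ∈ Finset.range n, t x k) (g := fun _ => 0) (H := fun x i z y => z + t x i = y) (by fun_prop)
    (by fun_prop) (by simp) (by simp [Finset.sum_range_succ])) .id hn

theorem nth_prime_succ_eq_iff (i y : ℕ) : Nat.nth Nat.Prime (i + 1) = y ↔
    y.Prime ∧ Nat.nth Nat.Prime i < y ∧ ∀ z, z.Prime → Nat.nth Nat.Prime i < z → y ≤ z := by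
  have hmono := Nat.nth_strictMono Nat.infinite_setOfPred_prime
  have hle : ∀ z, z.Prime → Nat.nth Nat.Prime i < z → Nat.nth Nat.Prime (i + 1) ≤ z :=
    fun z hz hiz => by
      by_contra! h
      exact (Nat.le_nth_of_lt_nth_succ h hz).not_gt hiz
  constructor
  · rintro rfl
    exact ⟨Nat.prime_nth_prime _, hmono i.lt_succ_self, hle⟩
  · rintro ⟨hy, hiy, h⟩
    exact (hle y hy hiy).antisymm (h _ (Nat.prime_nth_prime _) (hmono i.lt_succ_self))

@[fun_prop]
theorem DFun.nth_prime {f : X → ℕ} (hf : DFun L M f) :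
    DFun L M fun x => Nat.nth Nat.Prime (f x) :=
  -- The recursion has no parameter; `hf` also fills the ignored parameter slot.
  DFun.comp₂ (Y := ℕ) (F := fun _ n => Nat.nth Nat.Prime n) (.of_rec (g := fun _ => 2)
    (H := fun _ _ z y => y.Prime ∧ z < y ∧ ∀ w, w.Prime → z < w → y ≤ w) (by fun_prop)
    (by fun_prop) (by simp) fun _ i y => nth_prime_succ_eq_iff i y) hf hf

theorem factorization_eq_iff {p : ℕ} (hp : p.Prime) {n : ℕ} (hn : n ≠ 0) (m : ℕ) :
    n.factorization p = m ↔ p ^ m ∣ n ∧ ¬ p ^ (m + 1) ∣ n := by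
  rw [hp.pow_dvd_iff_le_factorization hn, hp.pow_dvd_iff_le_factorization hn]
  lia

@[fun_prop]
theorem DFun.factorization_nth_prime {f g : X → ℕ} (hf : DFun L M f) (hg : DFun L M g) :
    DFun L M fun x => (f x).factorization (Nat.nth Nat.Prime (g x)) :=
  .of_graph (p := fun x y => (f x = 0 ∧ y = 0) ∨ (¬ f x = 0 ∧
    Nat.nth Nat.Prime (g x) ^ y ∣ f x ∧ ¬ Nat.nth Nat.Prime (g x) ^ (y + 1) ∣ f x))
    (by fun_prop) fun x y => by
      by_cases h : f x = 0
      · simp [h, eq_comm]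
      · simp [h, factorization_eq_iff (Nat.prime_nth_prime _) h]

end Arithmetical

end FirstOrder.Language

/-! ### The prime code: multiplicities, bijectivity, column lengths -/

namespace YoungDiagram

theorem primeNumber_succ (k : ℕ) : primeNumber (k + 1) = Nat.nth Nat.Prime k := rfl

theorem nth_prime_injective : Function.Injective (Nat.nth Nat.Prime) :=
  Nat.nth_injective Nat.infinite_setOfPred_prime

theorem prod_map_primeNumber_ne_zero (l : List ℕ) : (l.map primeNumber).prod ≠ 0 := by
  simp only [ne_eq, List.prod_eq_zero_iff, List.mem_map, not_exists, not_and]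
  exact fun n _ => (Nat.prime_nth_prime _).ne_zero

theorem factorization_prod_map_primeNumber (l : List ℕ) (hl : ∀ x ∈ l, 0 < x) (k : ℕ) :
    (l.map primeNumber).prod.factorization (Nat.nth Nat.Prime k) = l.count (k + 1) := by
  induction l with
  | nil => simp
  | cons x l ih =>
    obtain ⟨x, rfl⟩ := Nat.exists_eq_succ_of_ne_zero (hl x (by simp)).ne'
    rw [List.map_cons, List.prod_cons, Nat.succ_eq_add_one, primeNumber_succ,
      Nat.factorization_mul (Nat.prime_nth_prime _).ne_zero (prod_map_primeNumber_ne_zero l),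
      Finsupp.add_apply, ih fun y hy => hl y (by simp [hy]), (Nat.prime_nth_prime x).factorization,
      List.count_cons, add_comm, Finsupp.single_apply]
    simp [nth_prime_injective.eq_iff]

open Classical in
/-- The multiplicity of the part `k + 1` in the partition with prime code `n`. -/
noncomputable def codeMult (n k : ℕ) : ℕ :=
  if n = 0 then 0
  else n.factorization (Nat.nth Nat.Prime k) + if k = 0 ∧ ∃ m, n = 2 ^ m then 1 else 0

theorem primeCode_eq_prod {μ : YoungDiagram} (h : ¬ ∀ n ∈ μ.rowLens, n = 1) :
    primeCode μ = (μ.rowLens.map primeNumber).prod := by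
  have h' : μ.rowLens ≠ [] := by rintro h'; simp [h'] at h
  rw [primeCode, if_neg h', if_neg h, Finset.prod_list_map_count]

theorem primeCode_eq_pow {μ : YoungDiagram} {m : ℕ} (h : μ.rowLens = List.replicate (m + 1) 1) :
    primeCode μ = 2 ^ m := by
  rw [primeCode, if_neg (by simp [h]), if_pos (by simp [h]), h]
  simp [primeNumber]

theorem exists_rowLens_eq_replicate {μ : YoungDiagram} (h₀ : μ.rowLens ≠ [])
    (h : ∀ n ∈ μ.rowLens, n = 1) : ∃ m, μ.rowLens = List.replicate (m + 1) 1 := by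
  have h₁ := List.eq_replicate_of_mem h
  obtain ⟨m, hm⟩ := Nat.exists_eq_succ_of_ne_zero (mt List.length_eq_zero_iff.1 h₀)
  exact ⟨m, by rwa [hm] at h₁⟩

/-- The added 1 in `codeMult` undoes the exponent shift for partitions into ones. It is triggered
for no other partition: a part larger than 1 contributes an odd prime, so the code is not a power of
2. -/
theorem codeMult_primeCode (μ : YoungDiagram) (k : ℕ) :
    codeMult (primeCode μ) k = μ.rowLens.count (k + 1) := by
  by_cases h₀ : μ.rowLens = []
  · simp [codeMult, primeCode, h₀]
  by_cases h : ∀ n ∈ μ.rowLens, n = 1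
  · obtain ⟨m, hm⟩ := exists_rowLens_eq_replicate h₀ h
    rw [primeCode_eq_pow hm, hm, codeMult, if_neg (by positivity), Nat.Prime.factorization_pow
      Nat.prime_two, List.count_replicate, Finsupp.single_apply, ← Nat.nth_prime_zero_eq_two]
    by_cases hk : k = 0
    · simp [hk]
    · rw [if_neg (nth_prime_injective.ne (Ne.symm hk))]
      simp [hk]
  · have hfac := factorization_prod_map_primeNumber _ μ.pos_of_mem_rowLens
    rw [primeCode_eq_prod h, codeMult, if_neg (prod_map_primeNumber_ne_zero _), hfac,
      if_neg, add_zero]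
    rintro ⟨-, m, hm⟩
    push Not at h
    obtain ⟨n, hn, hn1⟩ := h
    have hpos := μ.pos_of_mem_rowLens n hn
    obtain ⟨j, rfl⟩ : ∃ j, n = j + 1 + 1 := ⟨n - 2, by lia⟩
    have := hfac (j + 1)
    rw [hm, Nat.prime_two.factorization_pow, Finsupp.single_apply, if_neg] at this
    · exact (List.count_pos_iff.2 hn).ne this
    · rw [← Nat.nth_prime_zero_eq_two, nth_prime_injective.eq_iff]
      lia

theorem count_zero_rowLens (μ : YoungDiagram) : μ.rowLens.count 0 = 0 :=
  List.count_eq_zero.2 fun h => (μ.pos_of_mem_rowLens 0 h).ne rfl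

/-- The code determines all multiplicities, hence the parts up to order, and row lengths are sorted.
-/
theorem primeCode_injective : Function.Injective primeCode := by
  intro μ ν h
  have hperm : μ.rowLens.Perm ν.rowLens := List.perm_iff_count.2 fun n => by
    cases n with
    | zero => rw [count_zero_rowLens, count_zero_rowLens]
    | succ k => rw [← codeMult_primeCode, h, codeMult_primeCode]
  exact equivListRowLens.injective (Subtype.ext
    (hperm.eq_of_pairwise' μ.rowLens_sorted.pairwise ν.rowLens_sorted.pairwise))

theorem exists_rowLens_perm (l : List ℕ) (hl : ∀ x ∈ l, 0 < x) :
    ∃ μ : YoungDiagram, μ.rowLens.Perm l := by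
  have hperm := List.mergeSort_perm l (· ≥ ·)
  refine ⟨ofRowLens (l.mergeSort (· ≥ ·)) ?_, ?_⟩
  · exact (List.pairwise_mergeSort' (· ≥ ·) l).sortedGE
  · rwa [rowLens_ofRowLens_eq_self fun x hx => hl x (hperm.mem_iff.1 hx)]

theorem primeCode_surjective : Function.Surjective primeCode := by
  intro n
  rcases eq_or_ne n 0 with rfl | hn
  · obtain ⟨μ, hμ⟩ := exists_rowLens_perm [] (by simp)
    exact ⟨μ, if_pos hμ.eq_nil⟩
  by_cases hpow : ∃ m, n = 2 ^ m
  · obtain ⟨m, rfl⟩ := hpow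
    obtain ⟨μ, hμ⟩ := exists_rowLens_perm (List.replicate (m + 1) 1) (by simp)
    exact ⟨μ, primeCode_eq_pow (List.perm_replicate.1 hμ)⟩
  -- Each prime factor `p` gives the part equal to its 1-based index among the primes.
  · obtain ⟨μ, hμ⟩ := exists_rowLens_perm
      (n.primeFactorsList.map fun p => Nat.count Nat.Prime p + 1) (by
        simp only [List.forall_mem_map]; exact fun _ _ => Nat.succ_pos _)
    have hprod : (μ.rowLens.map primeNumber).prod = n := by
      rw [(hμ.map primeNumber).prod_eq, List.map_map, List.map_congr_left (g := id),
        List.map_id, Nat.prod_primeFactorsList hn]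
      intro p hp
      exact Nat.nth_count (Nat.prime_of_mem_primeFactorsList hp)
    refine ⟨μ, (primeCode_eq_prod fun h => hpow ⟨μ.rowLens.length, ?_⟩).trans hprod⟩
    rw [← hprod, List.eq_replicate_of_mem h]
    simp [primeNumber]

theorem primeCode_bijective : Function.Bijective primeCode :=
  ⟨primeCode_injective, primeCode_surjective⟩

/-- The number of parts larger than `j` in the partition with prime code `n`. -/
noncomputable def codeColLen (n j : ℕ) : ℕ :=
  ∑ k ∈ Finset.range (n + 1), if j ≤ k then codeMult n k else 0

theorem colLen_eq_countP (μ : YoungDiagram) (j : ℕ) :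
    μ.colLen j = μ.rowLens.countP (j < ·) := by
  have h : (Finset.range (μ.colLen 0)).filter (j < μ.rowLen ·) = Finset.range (μ.colLen j) := by
    ext i
    have := μ.colLen_anti 0 j j.zero_le
    simp only [Finset.mem_filter, Finset.mem_range, ← mem_iff_lt_rowLen, mem_iff_lt_colLen]
    lia
  rw [← Finset.card_range (μ.colLen j), ← h, rowLens, List.countP_map]
  simp only [Finset.card_def, Finset.filter_val, Finset.range_val, Multiset.range,
    Multiset.filter_coe, Multiset.coe_card, List.countP_eq_length_filter]
  rfl

theorem countP_lt_eq_sum (l : List ℕ) (N j : ℕ) (hl : ∀ x ∈ l, 0 < x ∧ x ≤ N) :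
    l.countP (j < ·) = ∑ k ∈ Finset.range N, if j ≤ k then l.count (k + 1) else 0 := by
  induction l with
  | nil => simp
  | cons x l ih =>
    have hx := hl x (by simp)
    obtain ⟨y, rfl⟩ : ∃ y, x = y + 1 := ⟨x - 1, by lia⟩
    rw [List.countP_cons, ih fun z hz => hl z (by simp [hz]),
      ← Finset.sum_ite_eq_of_mem' (Finset.range N) y
        (fun _ => if decide (j < y + 1) = true then 1 else 0) (by simp; lia),
      ← Finset.sum_add_distrib]
    refine Finset.sum_congr rfl fun k _ => ?_
    rw [List.count_cons]
    by_cases hk : k = y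
    · subst hk; by_cases hj : j ≤ k <;> simp [hj]
    · simp [hk, Ne.symm hk]

/-- Truncating the sum loses nothing: for `k ≥ 1` a part `k + 1` makes the code divisible by a prime
that is at least `k`, so `k` is at most the code. -/
theorem codeColLen_primeCode (μ : YoungDiagram) (j : ℕ) :
    codeColLen (primeCode μ) j = μ.colLen j := by
  rw [colLen_eq_countP, countP_lt_eq_sum _ (primeCode μ + 1) j, codeColLen]
  · simp only [codeMult_primeCode]
  · intro x hx
    have hx0 := μ.pos_of_mem_rowLens x hx
    obtain ⟨k, rfl⟩ : ∃ k, x = k + 1 := ⟨x - 1, by lia⟩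
    refine ⟨hx0, Nat.succ_le_succ ?_⟩
    have h := List.count_pos_iff.2 hx
    rw [← codeMult_primeCode, codeMult] at h
    by_contra! hk
    have h₀ : k ≠ 0 := by lia
    have hn : primeCode μ ≠ 0 := by rintro h'; simp [h'] at h
    have h₁ := (Nat.infinite_setOfPred_prime |> Nat.nth_strictMono).le_apply (x := k)
    rw [if_neg hn, if_neg (by simp [h₀]), Nat.factorization_eq_zero_of_lt (by lia)] at h
    exact h.ne rfl

end YoungDiagram

/-! ### Definability of the column lengths -/

namespace FirstOrder.Language

variable {L : Language.{0, 0}} {M : Type} [L.Structure M] [Arithmetical L M]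
  {X : Type} [Coded L M X]

open YoungDiagram

@[fun_prop]
theorem DFun.codeColLen {f g : X → ℕ} (hf : DFun L M f) (hg : DFun L M g) :
    DFun L M fun x => codeColLen (f x) (g x) := by
  classical
  unfold YoungDiagram.codeColLen codeMult
  exact DFun.sum_range (by fun_prop) (by fun_prop)

end FirstOrder.Language

/-! ### Order-theoretic descriptions of cells, sums and products -/

namespace YoungDiagram

/-- The Young diagram whose `i`-th row has length `f i`. -/
def ofAntitone (f : ℕ → ℕ) (hf : ∀ i j, i ≤ j → f j ≤ f i) (N : ℕ) (_ : f N = 0) : YoungDiagram where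
  cells := (Finset.range N ×ˢ Finset.range (f 0)).filter fun c => c.2 < f c.1
  isLowerSet := by
    rintro ⟨i, j⟩ ⟨i', j'⟩ ⟨hi, hj⟩ h
    have := hf _ _ hi
    have := hf _ _ (Nat.zero_le i')
    simp only [Finset.coe_filter, Finset.mem_product, Finset.mem_range,
      Set.mem_ofPred_eq] at h hi hj ⊢
    lia

theorem mem_ofAntitone {f : ℕ → ℕ} {hf : ∀ i j, i ≤ j → f j ≤ f i} {N : ℕ} {hN : f N = 0} {c : ℕ × ℕ} :
    c ∈ ofAntitone f hf N hN ↔ c.2 < f c.1 := by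
  rw [← mem_cells, ofAntitone, Finset.mem_filter, Finset.mem_product, Finset.mem_range,
    Finset.mem_range, and_iff_right_iff_imp]
  intro h
  refine ⟨?_, h.trans_le (hf _ _ (Nat.zero_le _))⟩
  by_contra! h'
  have := hf _ _ h'
  lia

/-- The diagram with a single row, of length `n`. -/
def singleRow (n : ℕ) : YoungDiagram :=
  ofAntitone (fun i => if i = 0 then n else 0) (fun i j h => by split_ifs <;> lia) 1 rfl

/-- The diagram with a single column, of length `n`. -/
def singleCol (n : ℕ) : YoungDiagram :=
  ofAntitone (fun i => if i < n then 1 else 0) (fun i j h => by split_ifs <;> lia) n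
    (by simp)

/-- The diagram with `m` rows of length `n`. -/
def rectangle (m n : ℕ) : YoungDiagram :=
  ofAntitone (fun i => if i < m then n else 0) (fun i j h => by split_ifs <;> lia) m
    (by simp)

/-- The diagram with rows of lengths `n`, `n - 1`, …, `1`. -/
def staircase (n : ℕ) : YoungDiagram :=
  ofAntitone (fun i => n - i) (fun i j h => by lia) n (by simp)

theorem mem_singleRow {n i j : ℕ} : (i, j) ∈ singleRow n ↔ i = 0 ∧ j < n := by
  rw [singleRow, mem_ofAntitone]; dsimp; split_ifs <;> simp [*]

theorem mem_singleCol {n i j : ℕ} : (i, j) ∈ singleCol n ↔ i < n ∧ j = 0 := by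
  rw [singleCol, mem_ofAntitone]; dsimp; split_ifs <;> simp [*]

theorem mem_rectangle {m n i j : ℕ} : (i, j) ∈ rectangle m n ↔ i < m ∧ j < n := by
  rw [rectangle, mem_ofAntitone]; dsimp; split_ifs <;> simp [*]

theorem mem_staircase {n i j : ℕ} : (i, j) ∈ staircase n ↔ i + j < n := by
  rw [staircase, mem_ofAntitone]; dsimp; lia

theorem rowLen_eq_iff {μ : YoungDiagram} {i n : ℕ} :
    μ.rowLen i = n ↔ ∀ j, (i, j) ∈ μ ↔ j < n := by
  simp only [mem_iff_lt_rowLen]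
  exact ⟨by rintro rfl; simp, fun h => eq_of_forall_lt_iff h⟩

theorem rowLen_ofAntitone {f : ℕ → ℕ} {hf : ∀ i j, i ≤ j → f j ≤ f i} {N : ℕ} {hN : f N = 0} (i : ℕ) :
    (ofAntitone f hf N hN).rowLen i = f i :=
  rowLen_eq_iff.2 fun _ => mem_ofAntitone

theorem le_iff_forall_mem {μ ν : YoungDiagram} : μ ≤ ν ↔ ∀ i j, (i, j) ∈ μ → (i, j) ∈ ν :=
  ⟨fun h _ _ hm => h hm, fun h ⟨i, j⟩ hm => h i j hm⟩

theorem ext_mem {μ ν : YoungDiagram} (h : ∀ i j, (i, j) ∈ μ ↔ (i, j) ∈ ν) : μ = ν :=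
  le_antisymm (le_iff_forall_mem.2 fun i j => (h i j).1) (le_iff_forall_mem.2 fun i j => (h i j).2)

theorem singleRow_le_iff {n : ℕ} {μ : YoungDiagram} : singleRow n ≤ μ ↔ n ≤ μ.rowLen 0 := by
  simp only [le_iff_forall_mem, mem_singleRow]
  exact ⟨fun h => le_of_forall_lt fun j hj => mem_iff_lt_rowLen.1 (h 0 j ⟨rfl, hj⟩),
    by rintro h i j ⟨rfl, hj⟩; exact mem_iff_lt_rowLen.2 (hj.trans_le h)⟩

theorem singleCol_le_iff {n : ℕ} {μ : YoungDiagram} : singleCol n ≤ μ ↔ n ≤ μ.colLen 0 := by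
  simp only [le_iff_forall_mem, mem_singleCol]
  exact ⟨fun h => le_of_forall_lt fun j hj => mem_iff_lt_colLen.1 (h j 0 ⟨hj, rfl⟩),
    by rintro h i j ⟨hi, rfl⟩; exact mem_iff_lt_colLen.2 (hi.trans_le h)⟩

theorem rowLen_zero_singleRow (n : ℕ) : (singleRow n).rowLen 0 = n :=
  rowLen_ofAntitone 0

theorem colLen_zero_singleCol (n : ℕ) : (singleCol n).colLen 0 = n := by
  refine eq_of_forall_lt_iff fun i => ?_
  rw [← mem_iff_lt_colLen, mem_singleCol, and_iff_left rfl]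

theorem singleRow_le_singleRow {m n : ℕ} : singleRow m ≤ singleRow n ↔ m ≤ n := by
  rw [singleRow_le_iff, rowLen_zero_singleRow]

theorem singleCol_le_singleCol {m n : ℕ} : singleCol m ≤ singleCol n ↔ m ≤ n := by
  rw [singleCol_le_iff, colLen_zero_singleCol]

theorem singleRow_injective : Function.Injective singleRow :=
  fun m n h => by rw [← rowLen_zero_singleRow m, h, rowLen_zero_singleRow]

theorem singleCol_injective : Function.Injective singleCol :=
  fun m n h => by rw [← colLen_zero_singleCol m, h, colLen_zero_singleCol]

theorem oneAddOne_eq : oneAddOne = singleCol 2 := by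
  refine ext_mem fun i j => ?_
  rw [oneAddOne, mem_ofRowLens, mem_singleCol]
  constructor
  · rintro ⟨h, h'⟩
    simp only [List.length_cons, List.length_nil, zero_add, Nat.reduceAdd] at h
    interval_cases i <;> simpa using h'
  · rintro ⟨h, rfl⟩
    refine ⟨h, ?_⟩
    interval_cases i <;> simp

theorem oneAddOne_le_iff {μ : YoungDiagram} : oneAddOne ≤ μ ↔ (1, 0) ∈ μ := by
  rw [oneAddOne_eq, singleCol_le_iff, mem_iff_lt_colLen, Nat.succ_le_iff]

theorem mem_range_singleRow_iff {μ : YoungDiagram} :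
    μ ∈ Set.range singleRow ↔ ¬ oneAddOne ≤ μ := by
  rw [oneAddOne_le_iff]
  constructor
  · rintro ⟨n, rfl⟩
    simp [mem_singleRow]
  · intro h
    refine ⟨μ.rowLen 0, ext_mem fun i j => ?_⟩
    rw [mem_singleRow, ← mem_iff_lt_rowLen]
    constructor
    · rintro ⟨rfl, hj⟩; exact hj
    · intro hm
      have : i = 0 := by
        by_contra hi
        exact h (μ.up_left_mem (Nat.one_le_iff_ne_zero.2 hi) (Nat.zero_le j) hm)
      exact ⟨this, this ▸ hm⟩

/-- By `mem_range_singleRow_iff` the `ν` are the one-row subdiagrams. Requiring them to fit in a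
column says that their length is at most 1, i.e. that the cell `(0, 1)` is absent. -/
theorem mem_range_singleCol_iff {μ : YoungDiagram} :
    μ ∈ Set.range singleCol ↔ ∀ ν ≤ μ, ¬ oneAddOne ≤ ν → ν ≤ oneAddOne := by
  constructor
  · rintro ⟨n, rfl⟩ ν hν h
    obtain ⟨m, rfl⟩ := mem_range_singleRow_iff.2 h
    rw [oneAddOne_eq, le_iff_forall_mem]
    intro i j hm
    have := le_iff_forall_mem.1 hν i j hm
    simp only [mem_singleRow, mem_singleCol] at *
    lia
  · intro h
    have h' : (0, 1) ∉ μ := by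
      intro hm
      have := h (singleRow 2) (singleRow_le_iff.2 (mem_iff_lt_rowLen.1 hm))
        (mem_range_singleRow_iff.1 ⟨2, rfl⟩)
      rw [oneAddOne_eq] at this
      have := le_iff_forall_mem.1 this 0 1 (mem_singleRow.2 (by simp))
      simp [mem_singleCol] at this
    refine ⟨μ.colLen 0, ext_mem fun i j => ?_⟩
    rw [mem_singleCol, ← mem_iff_lt_colLen]
    constructor
    · rintro ⟨hi, rfl⟩; exact hi
    · intro hm
      have : j = 0 := by
        by_contra hj
        exact h' (μ.up_left_mem (Nat.zero_le i) (Nat.one_le_iff_ne_zero.2 hj) hm)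
      exact ⟨this ▸ hm, this⟩

/-- The `(i + 1) × (j + 1)` rectangle is the largest diagram with the given bounds on its first row
and column, and it lies in `μ` exactly when its corner `(i, j)` does. -/
theorem mem_iff_forall_le {μ : YoungDiagram} {i j : ℕ} : (i, j) ∈ μ ↔
    ∀ ν, (∀ n, singleRow n ≤ ν → n ≤ j + 1) → (∀ n, singleCol n ≤ ν → n ≤ i + 1) → ν ≤ μ := by
  simp only [singleRow_le_iff, singleCol_le_iff]
  constructor
  · intro hm ν h₁ h₂
    rw [le_iff_forall_mem]
    intro i' j' hm'
    have hr := h₁ _ le_rfl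
    have hc := h₂ _ le_rfl
    have := mem_iff_lt_rowLen.1 (ν.up_left_mem (Nat.zero_le i') le_rfl hm')
    have := mem_iff_lt_colLen.1 (ν.up_left_mem le_rfl (Nat.zero_le j') hm')
    exact μ.up_left_mem (by lia) (by lia) hm
  · intro h
    refine le_iff_forall_mem.1 (h (rectangle (i + 1) (j + 1)) (fun n hn => ?_) fun n hn => ?_) i j
      (mem_rectangle.2 (by lia))
    · by_contra! hj
      exact absurd (mem_rectangle.1 (mem_iff_lt_rowLen.2 (hj.trans_le hn))).2 (by lia)
    · by_contra! hj
      exact absurd (mem_rectangle.1 (mem_iff_lt_colLen.2 (hj.trans_le hn))).1 (by lia)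

/-- Invariance along antidiagonals forces a staircase, whose first row and column have equal length.
This links numbers coded as columns with numbers coded as rows, which containment alone does not
compare. -/
theorem eq_iff_exists_staircase (m n : ℕ) : m = n ↔ ∃ μ : YoungDiagram,
    (∀ i j, (i + 1, j) ∈ μ ↔ (i, j + 1) ∈ μ) ∧ (∀ k, singleCol k ≤ μ ↔ k ≤ m) ∧
      ∀ k, singleRow k ≤ μ ↔ k ≤ n := by
  have hrow : ∀ (μ : YoungDiagram) n, (∀ k, singleRow k ≤ μ ↔ k ≤ n) ↔ μ.rowLen 0 = n := by
    simp only [singleRow_le_iff]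
    exact fun μ n => ⟨eq_of_forall_le_iff, by rintro rfl; simp⟩
  have hcol : ∀ (μ : YoungDiagram) n, (∀ k, singleCol k ≤ μ ↔ k ≤ n) ↔ μ.colLen 0 = n := by
    simp only [singleCol_le_iff]
    exact fun μ n => ⟨eq_of_forall_le_iff, by rintro rfl; simp⟩
  simp only [hrow, hcol]
  constructor
  · rintro rfl
    refine ⟨staircase m, by simp only [mem_staircase]; lia, ?_, rowLen_ofAntitone 0⟩
    exact eq_of_forall_lt_iff fun k => by rw [← mem_iff_lt_colLen, mem_staircase, add_zero]
  · rintro ⟨μ, h, rfl, rfl⟩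
    have key : ∀ i j, (i, j) ∈ μ ↔ (0, i + j) ∈ μ := by
      intro i
      induction i with
      | zero => simp
      | succ i ih =>
        intro j
        rw [h, ih, add_right_comm, add_assoc]
    exact eq_of_forall_lt_iff fun k => by
      rw [← mem_iff_lt_colLen, key, add_zero, mem_iff_lt_rowLen]

/-- Row lengths form a sequence falling by 1 for `b` steps from `c` to `a`, so only successor and
`rowLen` are needed. -/
theorem add_eq_iff_exists (a b c : ℕ) : a + b = c ↔ ∃ μ : YoungDiagram,
    μ.rowLen 0 = c ∧ μ.rowLen b = a ∧ ∀ i, i < b → μ.rowLen i = μ.rowLen (i + 1) + 1 := by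
  constructor
  · rintro rfl
    refine ⟨staircase (a + b), ?_⟩
    simp only [staircase, rowLen_ofAntitone]
    lia
  · rintro ⟨μ, rfl, rfl, h⟩
    induction b with
    | zero => rfl
    | succ b ih =>
      rw [← ih fun i hi => h i (by lia), h b b.lt_succ_self]
      lia

/-- The same device with steps of size `a`, which addition makes expressible. -/
theorem mul_eq_iff_exists (a b c : ℕ) : a * b = c ↔ ∃ μ : YoungDiagram,
    μ.rowLen 0 = c ∧ μ.rowLen b = 0 ∧ ∀ i, i < b → μ.rowLen i = μ.rowLen (i + 1) + a := by
  constructor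
  · rintro rfl
    refine ⟨ofAntitone (fun i => a * (b - i))
      (fun i j h => Nat.mul_le_mul_left a (by lia)) b (by simp), ?_⟩
    simp only [rowLen_ofAntitone]
    refine ⟨rfl, by simp, fun i hi => ?_⟩
    rw [← Nat.mul_succ]
    congr 1
    lia
  · rintro ⟨μ, rfl, hb, h⟩
    have key : ∀ k ≤ b, μ.rowLen (b - k) = a * k := by
      intro k
      induction k with
      | zero => simp [hb]
      | succ k ih =>
        intro hk
        rw [h _ (by lia), show b - (k + 1) + 1 = b - k by lia, ih (by lia), Nat.mul_succ]
    rw [← key b le_rfl, Nat.sub_self]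

end YoungDiagram

/-! ### Translating formulas between languages -/

namespace FirstOrder.Language

open Coded

section Transfer

variable {L L' : Language.{0, 0}} {M : Type} [L.Structure M] [L'.Structure M]
  {α : Type} [Finite α] {X : Type} [Coded L M X]

/-- Tuples code themselves, so variable assignments can be treated as definable arguments. -/
instance Coded.pi (L : Language.{0, 0}) (M : Type) [L.Structure M] (α : Type) [Finite α] :
    Coded L M (α → M) where
  Idx := α
  code := id
  code_injective := Function.injective_id
  definable_range := ⟨⊤, fun v => by simp⟩

theorem DRel.forall_finite {p : α → X → Prop} (h : ∀ i, DRel L M (p i)) :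
    DRel L M fun x => ∀ i, p i x := by
  choose φ hφ using h
  refine ⟨BoundedFormula.iInf φ, fun x => ?_⟩
  rw [Formula.Realize, BoundedFormula.realize_iInf]
  exact forall_congr' fun i => hφ i x

theorem DFun.apply {f : X → α → M} (hf : DFun L M f) (i : α) : DFun L M fun x => f x i :=
  DFun.comp (g := fun v : α → M => v i) (Reindexing.dfun ⟨fun _ => i, fun _ => rfl⟩) hf

theorem DFun.pi {f : X → α → M} (hf : ∀ i, DFun L M fun x => f x i) : DFun L M f :=
  .of_graph (p := fun x y => ∀ i, f x i = y i)
    (DRel.forall_finite fun i => DRel.eq (DFun.comp (hf i) (.fst .id)) (.apply (.snd .id) i))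
    fun _ _ => funext_iff

theorem DRel.relMap {n : ℕ} (R : L.Relations n) :
    DRel L M fun v : Fin n → M => Structure.RelMap R v :=
  ⟨R.formula Term.var, fun _ => Formula.realize_rel⟩

theorem DFun.funMap {n : ℕ} (f : L.Functions n) :
    DFun L M fun v : Fin n → M => Structure.funMap f v :=
  ⟨(Term.func f fun i => Term.var (Sum.inl i)).equal (Term.var (Sum.inr ())),
    fun _ => Formula.realize_equal⟩

theorem DFun.vec₂ {f g : X → M} (hf : DFun L M f) (hg : DFun L M g) :
    DFun L M fun x => ![f x, g x] :=
  .pi <| Fin.forall_fin_two.2 ⟨hf, hg⟩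

theorem DFun.vec₃ {f g h : X → M} (hf : DFun L M f) (hg : DFun L M g) (hh : DFun L M h) :
    DFun L M fun x => ![f x, g x, h x] :=
  .pi <| Fin.forall_fin_succ.2 ⟨hf, Fin.forall_fin_two.2 ⟨hg, hh⟩⟩

theorem DFun.term_realize
    (hfun : ∀ {n : ℕ} (f : L'.Functions n), DFun L M fun v : Fin n → M => Structure.funMap f v)
    {β : Type} {v : X → β → M} (hv : ∀ i, DFun L M fun x => v x i) (t : L'.Term β) :
    DFun L M fun x => t.realize (v x) := by
  induction t with
  | var i => exact hv i
  | func f ts ih => exact (hfun f).comp (.pi ih)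

theorem DRel.boundedFormula_realize
    (hfun : ∀ {n : ℕ} (f : L'.Functions n), DFun L M fun v : Fin n → M => Structure.funMap f v)
    (hrel : ∀ {n : ℕ} (R : L'.Relations n), DRel L M fun v : Fin n → M => Structure.RelMap R v)
    {n : ℕ} (φ : L'.BoundedFormula α n) :
    DRel L M fun q : (α → M) × (Fin n → M) => φ.Realize q.1 q.2 := by
  have hv : ∀ {n : ℕ} (i : α ⊕ Fin n),
      DFun L M fun q : (α → M) × (Fin n → M) => Sum.elim q.1 q.2 i := by
    rintro n (i | i)
    · exact .apply (by fun_prop) i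
    · exact .apply (by fun_prop) i
  induction φ with
  | falsum => exact .const _
  | equal t₁ t₂ => exact DRel.eq (DFun.term_realize hfun hv t₁) (DFun.term_realize hfun hv t₂)
  | rel R ts => exact (hrel R).comp (.pi fun i => DFun.term_realize hfun hv (ts i))
  | imp _ _ ih₁ ih₂ => exact ih₁.imp ih₂
  | all φ ih =>
    -- The bound variable becomes the last entry of the extended tuple.
    refine DRel.forall (ih.comp 
      (f := fun q : ((α → M) × (Fin _ → M)) × M => (q.1.1, Fin.snoc q.1.2 q.2)) ?_)
    refine .pair (by fun_prop) (.pi fun i => ?_)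
    induction i using Fin.lastCases with
    | last => simp only [Fin.snoc_last]; fun_prop
    | cast i => simp only [Fin.snoc_castSucc]; exact .apply (by fun_prop) i

/-- If the symbols of `L'` have definable interpretations in an `L`-structure, then so do all
the formulas of `L'`. -/
theorem definableRelations_subset
    (hfun : ∀ {n : ℕ} (f : L'.Functions n), DFun L M fun v : Fin n → M => Structure.funMap f v)
    (hrel : ∀ {n : ℕ} (R : L'.Relations n), DRel L M fun v : Fin n → M => Structure.RelMap R v) :
    definableRelations L' M inferInstance ⊆ definableRelations L M inferInstance := by
  rintro ⟨k, R⟩ ⟨φ, hφ⟩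
  obtain ⟨ψ, hψ⟩ := (DRel.boundedFormula_realize hfun hrel φ).comp
    (f := fun v : Fin k → M => (v, default)) (.pair .id (.pi fun i => i.elim0))
  exact ⟨ψ, fun v => (hφ v).trans (hψ v).symm⟩

end Transfer

end FirstOrder.Language

/-! ### Arithmetic inside Young's lattice -/

namespace YoungDiagram

open FirstOrder FirstOrder.Language

section Star

attribute [local instance] starStructure

variable {X : Type} [Coded starLanguage YoungDiagram X]

@[fun_prop]
theorem dRel_le {f g : X → YoungDiagram} (hf : DFun starLanguage YoungDiagram f)
    (hg : DFun starLanguage YoungDiagram g) :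
    DRel starLanguage YoungDiagram fun x => f x ≤ g x :=
  (DRel.relMap (Sum.inl orderRel.le : starLanguage.Relations 2)).comp (hf.vec₂ hg)

@[fun_prop]
theorem dFun_oneAddOne : DFun starLanguage YoungDiagram fun _ : X => oneAddOne := by
  have h := (DFun.funMap (L := starLanguage) (M := YoungDiagram) (n := 0) (Sum.inr ())).comp
    (f := fun _ : X => Fin.elim0) (.pi fun i => i.elim0)
  exact h

/-- A natural number, to be interpreted by a one-column diagram. -/
@[ext]
structure ColumnNat where
  val : ℕ

instance codedNat : Coded starLanguage YoungDiagram ℕ where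
  Idx := Unit
  code n _ := singleRow n
  code_injective _ _ h := singleRow_injective (congrFun h ())
  definable_range := by
    obtain ⟨φ, hφ⟩ : DRel starLanguage YoungDiagram fun μ => ¬ oneAddOne ≤ μ := by fun_prop
    refine ⟨φ, fun v => (hφ (v ())).trans (mem_range_singleRow_iff.symm.trans ?_)⟩
    exact exists_congr fun n => ⟨fun h => funext fun _ => h, fun h => congrFun h ()⟩

/-- A cell has its row index measured by columns and its column index by rows; until the two codings
are matched in `dFun_columnNat_mk` they must live on distinct types. -/
instance codedColumnNat : Coded starLanguage YoungDiagram ColumnNat where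
  Idx := Unit
  code n _ := singleCol n.val
  code_injective _ _ h := ColumnNat.ext (singleCol_injective (congrFun h ()))
  definable_range := by
    obtain ⟨φ, hφ⟩ : DRel starLanguage YoungDiagram
      fun μ => ∀ ν, ν ≤ μ → ¬ oneAddOne ≤ ν → ν ≤ oneAddOne := by fun_prop
    refine ⟨φ, fun v => (hφ (v ())).trans (mem_range_singleCol_iff.symm.trans ?_)⟩
    exact ⟨fun ⟨n, h⟩ => ⟨⟨n⟩, funext fun _ => h⟩, fun ⟨n, h⟩ => ⟨n.val, congrFun h ()⟩⟩

@[fun_prop]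
theorem dFun_singleRow {f : X → ℕ} (hf : DFun starLanguage YoungDiagram f) :
    DFun starLanguage YoungDiagram fun x => singleRow (f x) :=
  DFun.comp (Reindexing.dfun ⟨_root_.id, fun _ => rfl⟩) hf

@[fun_prop]
theorem dFun_singleCol {f : X → ColumnNat} (hf : DFun starLanguage YoungDiagram f) :
    DFun starLanguage YoungDiagram fun x => singleCol (f x).val :=
  DFun.comp (g := fun n : ColumnNat => singleCol n.val)
    (Reindexing.dfun ⟨_root_.id, fun _ => rfl⟩) hf

@[fun_prop]
theorem dRel_nat_le {f g : X → ℕ} (hf : DFun starLanguage YoungDiagram f)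
    (hg : DFun starLanguage YoungDiagram g) :
    DRel starLanguage YoungDiagram fun x => f x ≤ g x :=
  .congr (p := fun x => singleRow (f x) ≤ singleRow (g x)) (by fun_prop)
    fun _ => singleRow_le_singleRow.symm

@[fun_prop]
theorem dRel_columnNat_le {f g : X → ColumnNat} (hf : DFun starLanguage YoungDiagram f)
    (hg : DFun starLanguage YoungDiagram g) :
    DRel starLanguage YoungDiagram fun x => (f x).val ≤ (g x).val :=
  .congr (p := fun x => singleCol (f x).val ≤ singleCol (g x).val) (by fun_prop)
    fun _ => singleCol_le_singleCol.symm

@[fun_prop]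
theorem dRel_nat_lt {f g : X → ℕ} (hf : DFun starLanguage YoungDiagram f)
    (hg : DFun starLanguage YoungDiagram g) :
    DRel starLanguage YoungDiagram fun x => f x < g x :=
  .congr (p := fun x => ¬ g x ≤ f x) (by fun_prop) fun _ => not_le.symm

@[fun_prop]
theorem dFun_zero : DFun starLanguage YoungDiagram fun _ : X => 0 :=
  .of_graph (p := fun _ y => ∀ z, y ≤ z) (by fun_prop)
    fun _ _ => ⟨by rintro rfl; exact Nat.zero_le, fun h => (Nat.le_zero.1 (h 0)).symm⟩

@[fun_prop]
theorem dFun_succ {f : X → ℕ} (hf : DFun starLanguage YoungDiagram f) :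
    DFun starLanguage YoungDiagram fun x => f x + 1 :=
  .of_graph (p := fun x y => f x < y ∧ ∀ z, f x < z → y ≤ z) (by fun_prop) fun x y =>
    ⟨by rintro rfl; exact ⟨Nat.lt_succ_self _, fun _ => id⟩,
      fun h => (h.2 _ (Nat.lt_succ_self _)).antisymm' h.1⟩

@[fun_prop]
theorem dFun_columnNat_succ {f : X → ColumnNat} (hf : DFun starLanguage YoungDiagram f) :
    DFun starLanguage YoungDiagram fun x => ColumnNat.mk ((f x).val + 1) :=
  .of_graph (p := fun x y => ¬ y.val ≤ (f x).val ∧ ∀ z : ColumnNat, ¬ z.val ≤ (f x).val →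
    y.val ≤ z.val) (by fun_prop) fun x y => by
      rw [ColumnNat.ext_iff]
      constructor
      · rintro h
        rw [← h]
        exact ⟨by simp, fun z hz => by simpa using hz⟩
      · rintro ⟨h, h'⟩
        exact (h' ⟨(f x).val + 1⟩ (by simp)).antisymm' (not_le.1 h)

@[fun_prop]
theorem dRel_cell {f : X → ColumnNat} {g : X → ℕ} {m : X → YoungDiagram}
    (hf : DFun starLanguage YoungDiagram f) (hg : DFun starLanguage YoungDiagram g)
    (hm : DFun starLanguage YoungDiagram m) :
    DRel starLanguage YoungDiagram fun x => ((f x).val, g x) ∈ m x :=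
  .congr (p := fun x => ∀ ν, (∀ n, singleRow n ≤ ν → n ≤ g x + 1) →
    (∀ n : ColumnNat, singleCol n.val ≤ ν → n.val ≤ (ColumnNat.mk ((f x).val + 1)).val) → ν ≤ m x)
    (by fun_prop)
    fun x => mem_iff_forall_le.trans <| forall_congr' fun ν => imp_congr_right fun _ =>
      imp_congr_left ⟨fun h n => h n.val, fun h n => h ⟨n⟩⟩

@[fun_prop]
theorem dFun_columnNat_mk {f : X → ℕ} (hf : DFun starLanguage YoungDiagram f) :
    DFun starLanguage YoungDiagram fun x => ColumnNat.mk (f x) :=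
  .of_graph (p := fun x y => ∃ μ : YoungDiagram,
    (∀ (i : ColumnNat) (j : ℕ), ((ColumnNat.mk (i.val + 1)).val, j) ∈ μ ↔ (i.val, j + 1) ∈ μ) ∧
    (∀ k : ColumnNat, singleCol k.val ≤ μ ↔ k.val ≤ y.val) ∧ ∀ k, singleRow k ≤ μ ↔ k ≤ f x)
    (by fun_prop) fun x y => by
      rw [ColumnNat.ext_iff, eq_comm, eq_iff_exists_staircase]
      refine exists_congr fun μ => and_congr ?_ (and_congr_left' ?_)
      · exact ⟨fun h i j => h i.val j, fun h i j => h ⟨i⟩ j⟩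
      · exact ⟨fun h k => h k.val, fun h k => h ⟨k⟩⟩

@[fun_prop]
theorem dRel_mem {f g : X → ℕ} {m : X → YoungDiagram} (hf : DFun starLanguage YoungDiagram f)
    (hg : DFun starLanguage YoungDiagram g) (hm : DFun starLanguage YoungDiagram m) :
    DRel starLanguage YoungDiagram fun x => (f x, g x) ∈ m x :=
  dRel_cell (dFun_columnNat_mk hf) hg hm

@[fun_prop]
theorem dFun_rowLen {f : X → ℕ} {m : X → YoungDiagram} (hf : DFun starLanguage YoungDiagram f)
    (hm : DFun starLanguage YoungDiagram m) :
    DFun starLanguage YoungDiagram fun x => (m x).rowLen (f x) :=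
  .of_graph (p := fun x y => ∀ j, (f x, j) ∈ m x ↔ j < y) (by fun_prop)
    fun _ _ => rowLen_eq_iff

theorem dRel_add :
    DRel starLanguage YoungDiagram fun q : ℕ × ℕ × ℕ => q.1 + q.2.1 = q.2.2 :=
  .congr (p := fun q => ∃ μ : YoungDiagram, μ.rowLen 0 = q.2.2 ∧ μ.rowLen q.2.1 = q.1 ∧
    ∀ i, i < q.2.1 → μ.rowLen i = μ.rowLen (i + 1) + 1) (by fun_prop)
    fun _ => add_eq_iff_exists _ _ _

theorem dFun_add : DFun starLanguage YoungDiagram fun q : ℕ × ℕ => q.1 + q.2 :=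
  dRel_add.comp (f := fun q : (ℕ × ℕ) × ℕ => (q.1.1, q.1.2, q.2)) (by fun_prop)

theorem dRel_mul :
    DRel starLanguage YoungDiagram fun q : ℕ × ℕ × ℕ => q.1 * q.2.1 = q.2.2 := by
  have h : DFun starLanguage YoungDiagram fun q : ((ℕ × ℕ × ℕ) × YoungDiagram) × ℕ =>
      q.1.2.rowLen (q.2 + 1) + q.1.1.1 :=
    dFun_add.comp (f := fun q : ((ℕ × ℕ × ℕ) × YoungDiagram) × ℕ =>
      (q.1.2.rowLen (q.2 + 1), q.1.1.1)) (by fun_prop)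
  exact .congr (p := fun q => ∃ μ : YoungDiagram, μ.rowLen 0 = q.2.2 ∧ μ.rowLen q.2.1 = 0 ∧
    ∀ i, i < q.2.1 → μ.rowLen i = μ.rowLen (i + 1) + q.1)
    (DRel.and (by fun_prop) (DRel.and (by fun_prop)
      (DRel.imp (by fun_prop) (.eq (by fun_prop) h)).forall)).exists
    fun _ => mul_eq_iff_exists _ _ _

instance arithmeticalStar : Arithmetical starLanguage YoungDiagram where
  add := dRel_add
  mul := dRel_mul

/-- Column lengths determine the diagram. The right side mentions only cells and an arithmetical
function, so it defines the graph of the code within the lattice. -/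
theorem primeCode_eq_iff {μ : YoungDiagram} {n : ℕ} :
    primeCode μ = n ↔ ∀ i j, (i, j) ∈ μ ↔ i < codeColLen n j := by
  constructor
  · rintro rfl i j
    rw [codeColLen_primeCode, mem_iff_lt_colLen]
  · obtain ⟨ν, rfl⟩ := primeCode_surjective n
    intro h
    refine congrArg primeCode (ext_mem fun i j => ?_)
    rw [h, codeColLen_primeCode, mem_iff_lt_colLen]

@[fun_prop]
theorem dFun_primeCode {m : X → YoungDiagram} (hm : DFun starLanguage YoungDiagram m) :
    DFun starLanguage YoungDiagram fun x => primeCode (m x) :=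
  .of_graph (p := fun x n => ∀ i j, (i, j) ∈ m x ↔ i < codeColLen n j) (by fun_prop)
    fun _ _ => primeCode_eq_iff

theorem definableRelations_arithmetic_subset_star :
    definableRelations arithmeticLanguage YoungDiagram (pullbackArithmetic primeCode) ⊆
      definableRelations starLanguage YoungDiagram starStructure := by
  let _ := pullbackArithmetic primeCode
  refine definableRelations_subset (fun f => nomatch f) fun R => ?_
  have hv : ∀ i : Fin 3, DFun starLanguage YoungDiagram fun v : Fin 3 → YoungDiagram =>
    primeCode (v i) := fun i => dFun_primeCode (.apply .id i)
  cases R with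
  | add => exact DRel.eq ((hv 0).add (hv 1)) (hv 2)
  | mul => exact DRel.eq ((hv 0).mul (hv 1)) (hv 2)

end Star

/-! ### Young's lattice inside arithmetic -/

section PrimeCode

/-- Arithmetic transported to Young diagrams along the prime code. -/
noncomputable abbrev primeCodeStructure : arithmeticLanguage.Structure YoungDiagram :=
  pullbackArithmetic primeCode

attribute [local instance] primeCodeStructure

/-- The diagram with prime code `n`. -/
noncomputable def ofPrimeCode : ℕ → YoungDiagram :=
  (Equiv.ofBijective primeCode primeCode_bijective).symm

theorem primeCode_ofPrimeCode (n : ℕ) : primeCode (ofPrimeCode n) = n :=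
  (Equiv.ofBijective primeCode primeCode_bijective).apply_symm_apply n

theorem ofPrimeCode_primeCode (μ : YoungDiagram) : ofPrimeCode (primeCode μ) = μ :=
  (Equiv.ofBijective primeCode primeCode_bijective).symm_apply_apply μ

/-- Here a number is coded by the diagram whose prime code it is, so `primeCode` and its inverse act
as the identity on codes. -/
noncomputable instance codedNatPrimeCode : Coded arithmeticLanguage YoungDiagram ℕ where
  Idx := Unit
  code n _ := ofPrimeCode n
  code_injective _ _ h := (Equiv.injective _) (congrFun h ())
  definable_range := ⟨⊤, fun v => by
    simp only [Formula.realize_top, true_iff]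
    exact ⟨primeCode (v ()), funext fun _ => ofPrimeCode_primeCode _⟩⟩

theorem dFun_ofPrimeCode : DFun arithmeticLanguage YoungDiagram ofPrimeCode :=
  Reindexing.dfun ⟨_root_.id, fun _ => rfl⟩

variable {X : Type} [Coded arithmeticLanguage YoungDiagram X]

@[fun_prop]
theorem dFun_arithmetic_primeCode {m : X → YoungDiagram}
    (hm : DFun arithmeticLanguage YoungDiagram m) :
    DFun arithmeticLanguage YoungDiagram fun x => primeCode (m x) :=
  DFun.comp (Reindexing.dfun ⟨_root_.id, fun μ => funext fun _ => (ofPrimeCode_primeCode μ).symm⟩)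
    hm

noncomputable instance arithmeticalPrimeCode : Arithmetical arithmeticLanguage YoungDiagram where
  add := ((DRel.relMap ArithmeticRel.add).comp (.vec₃ (dFun_ofPrimeCode.comp (.fst .id))
    (dFun_ofPrimeCode.comp (.fst (.snd .id))) (dFun_ofPrimeCode.comp (.snd (.snd .id))))).congr
      fun q => by
        change _ ↔ primeCode (ofPrimeCode _) + primeCode (ofPrimeCode _) =
          primeCode (ofPrimeCode _)
        simp only [primeCode_ofPrimeCode]
  mul := ((DRel.relMap ArithmeticRel.mul).comp (.vec₃ (dFun_ofPrimeCode.comp (.fst .id))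
    (dFun_ofPrimeCode.comp (.fst (.snd .id))) (dFun_ofPrimeCode.comp (.snd (.snd .id))))).congr
      fun q => by
        change _ ↔ primeCode (ofPrimeCode _) * primeCode (ofPrimeCode _) =
          primeCode (ofPrimeCode _)
        simp only [primeCode_ofPrimeCode]

theorem le_iff_forall_codeColLen {μ ν : YoungDiagram} :
    μ ≤ ν ↔ ∀ j, codeColLen (primeCode μ) j ≤ codeColLen (primeCode ν) j := by
  simp only [codeColLen_primeCode, le_iff_forall_mem, mem_iff_lt_colLen]
  exact ⟨fun h j => le_of_forall_lt fun i => h i j, fun h i j hi => hi.trans_le (h j)⟩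

theorem definableRelations_star_subset_arithmetic :
    definableRelations starLanguage YoungDiagram starStructure ⊆
      definableRelations arithmeticLanguage YoungDiagram (pullbackArithmetic primeCode) := by
  let _ := starStructure
  refine definableRelations_subset (L := arithmeticLanguage) (fun {n} f => ?_) fun {n} R => ?_
  · rcases f with f | f
    · exact nomatch f
    · cases n with
      | zero =>
        -- The constant is pinned down by its code, a fixed natural number.
        exact .of_graph (p := fun _ μ => primeCode μ = primeCode oneAddOne) (by fun_prop)
          fun _ μ => eq_comm.trans primeCode_injective.eq_iff.symm
      | succ n => exact nomatch f
  · rcases R with R | R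
    · cases R with
      | le =>
        have hv : ∀ i : Fin 2, DFun arithmeticLanguage YoungDiagram
            fun q : (Fin 2 → YoungDiagram) × ℕ => primeCode (q.1 i) :=
          fun i => dFun_arithmetic_primeCode (.apply (.fst .id) i)
        exact .congr (p := fun v : Fin 2 → YoungDiagram =>
          ∀ j, codeColLen (primeCode (v 0)) j ≤ codeColLen (primeCode (v 1)) j)
          (DRel.le ((hv 0).codeColLen (.snd .id)) ((hv 1).codeColLen (.snd .id))).forall
          fun v => le_iff_forall_codeColLen
    · exact nomatch R

end PrimeCode

theorem definableRelations_star_eq_arithmetic :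
    definableRelations starLanguage YoungDiagram starStructure =
      definableRelations arithmeticLanguage YoungDiagram (pullbackArithmetic primeCode) :=
  definableRelations_star_subset_arithmetic.antisymm definableRelations_arithmetic_subset_star

end YoungDiagram

theorem theorem4p4 :
    Function.Bijective YoungDiagram.primeCode ∧
    definableRelations YoungDiagram.starLanguage YoungDiagram YoungDiagram.starStructure =
      definableRelations arithmeticLanguage YoungDiagram
        (pullbackArithmetic YoungDiagram.primeCode) ∧
    HasMaximalDefinabilityProperty YoungDiagram.starLanguage YoungDiagram
      YoungDiagram.starStructure :=
  ⟨YoungDiagram.primeCode_bijective, YoungDiagram.definableRelations_star_eq_arithmetic,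
    YoungDiagram.primeCode,
    ⟨YoungDiagram.primeCode_bijective, YoungDiagram.definableRelations_star_subset_arithmetic⟩,
    YoungDiagram.definableRelations_star_eq_arithmetic⟩
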